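/- Let $n\ge 0$ and let $D\subsetneq\mathbb C^n$ be a proper open subset, not necessarily connected or bounded. For $a\in D$ let $$I_{D,a}=\{X\in\mathbb C^n:\ a+\lambda X\in D\ \text{for all }\lambda\in\mathbb C\text{ with }|\lambda|\le 1\}$$ be the balanced indicatrix of $D$ at $a$ (so that $a+I_{D,a}$ is the largest balanced domain centred at $a$ and contained in $D$). An open set $G\subset\mathbb C^n$ is called pseudoconvex if there is a continuous plurisubharmonic function $u:G\to\mathbb R$ such that $\{z\in G: u(z)\le c\}$ is compact for every $c\in\mathbb R$. Let $U$ be a neighbourhood of the boundary $\partial D$ of $D$ in $\mathbb C^n$. If $I_{D,a}$ is pseudoconvex for every $a\in D\cap U$, then $D$ is pseudoconvex. -/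

import Mathlib

/-- A continuous plurisubharmonic function `u : D → ℝ` (only the values of `u` on `D` matter):
`u` is continuous on `D`, and it satisfies the sub-mean-value inequality on the boundary circle of
every closed affine complex disc `{a + ζ b : |ζ| ≤ 1}` contained in `D`. Continuity makes all the
circle averages genuine integrals. -/
def ContinuousPlurisubharmonicOn {E : Type*} [NormedAddCommGroup E] [NormedSpace ℂ E]
    (u : E → ℝ) (D : Set E) : Prop :=
  ContinuousOn u D ∧
    ∀ a b : E, (∀ ζ : ℂ, ‖ζ‖ ≤ 1 → a + ζ • b ∈ D) →
      u a ≤ Real.circleAverage (fun ζ : ℂ => u (a + ζ • b)) 0 1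

/-- An open set `D` is pseudoconvex if it carries a continuous plurisubharmonic exhaustion
function, i.e. one all of whose sublevel sets are compact subsets of `D`. -/
def IsPseudoconvex {E : Type*} [NormedAddCommGroup E] [NormedSpace ℂ E] (D : Set E) : Prop :=
  IsOpen D ∧ ∃ u : E → ℝ, ContinuousPlurisubharmonicOn u D ∧
    ∀ c : ℝ, IsCompact {z | z ∈ D ∧ u z ≤ c}

/-- The balanced indicatrix `I_{D,a}` of `D` at `a`. -/
def balancedIndicatrix {E : Type*} [NormedAddCommGroup E] [NormedSpace ℂ E]
    (D : Set E) (a : E) : Set E :=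
  {X | ∀ t : ℂ, ‖t‖ ≤ 1 → a + t • X ∈ D}

open Real Filter Topology Metric ComplexConjugate

/-! It suffices that `-log dist(·, Dᶜ)` is subharmonic on complex discs
(`isPseudoconvex_of_neg_log_infDist`). If it is not, a weighted minimum over points of the
complement (`neg_log_infDist_le_circleAverage`) gives a boundary point c + ξ touched from inside by
a region |t| < |1 + g w + γ w²| (1 + η|w|²) in the coordinates c + w b + t ξ.

Now take a = c + (1 - ε)ξ, close to c + ξ. A family of quadratic discs s X(z), s < 1, lies in the
indicatrix at a; their boundary circles stay in a compact subset of it as s → 1, while the centres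
tend to X(0), which is outside because a + X(0) = c + ξ. The maximum principle
`ContinuousPlurisubharmonicOn.le_of_quadratic_disc` bounds the exhaustion function at the centres,
contradicting compactness of its sublevel sets (`mem_of_forall_isPseudoconvex_balancedIndicatrix`).
The gain η|w|² makes the discs fit (`norm_lt_of_small`). -/

/-! ### Circle averages and real parts of entire functions -/

theorem circleAverage_re_of_differentiable {q : ℂ → ℂ} (hq : Differentiable ℂ q) :
    circleAverage (fun z => (q z).re) 0 1 = (q 0).re := by
  have h := Complex.reCLM.circleAverage_comp_comm (f := q) (c := 0) (R := 1)
    hq.continuous.continuousOn.circleIntegrable'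
  rw [DiffContOnCl.circleAverage hq.diffContOnCl] at h
  exact h

theorem circleAverage_le_re_of_le {q : ℂ → ℂ} (hq : Differentiable ℂ q) {h : ℂ → ℝ}
    (hh : ContinuousOn h (sphere 0 1)) (hle : ∀ z : ℂ, ‖z‖ = 1 → h z ≤ (q z).re) :
    circleAverage h 0 1 ≤ (q 0).re := by
  rw [← circleAverage_re_of_differentiable hq]
  refine circleAverage_mono (hh.circleIntegrable zero_le_one)
    (Complex.continuous_re.comp hq.continuous).continuousOn.circleIntegrable' ?_
  intro z hz
  exact hle z (by simpa using hz)

/-- Trigonometric polynomials are, up to real parts, boundary values of entire functions. -/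
theorem exists_entire_re_eq_of_mem_span_fourier {p : C(AddCircle (1 : ℝ), ℂ)}
    (hp : p ∈ Submodule.span ℂ (Set.range (fourier (T := 1)))) (c : ℂ) :
    ∃ q : ℂ → ℂ, Differentiable ℂ q ∧ ∀ x, (c * p x).re = (q (AddCircle.toCircle x)).re := by
  induction hp using Submodule.span_induction generalizing c with
  | mem p hp =>
    obtain ⟨n, rfl⟩ := hp
    obtain ⟨m, rfl | rfl⟩ := n.eq_nat_or_neg
    · refine ⟨fun z => c * z ^ m, by fun_prop, fun x => ?_⟩
      simp [AddCircle.toCircle_nsmul]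
    · refine ⟨fun z => conj c * z ^ m, by fun_prop, fun x => ?_⟩
      rw [fourier_neg, ← Complex.conj_re]
      simp [AddCircle.toCircle_nsmul]
  | zero => exact ⟨fun _ => 0, by fun_prop, by simp⟩
  | add p₁ p₂ _ _ h₁ h₂ =>
    obtain ⟨q₁, hq₁, e₁⟩ := h₁ c
    obtain ⟨q₂, hq₂, e₂⟩ := h₂ c
    refine ⟨fun z => q₁ z + q₂ z, by fun_prop, fun x => ?_⟩
    rw [ContinuousMap.add_apply, mul_add, Complex.add_re, Complex.add_re, e₁, e₂]
  | smul k p _ h =>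
    obtain ⟨q, hq, e⟩ := h (c * k)
    refine ⟨q, hq, fun x => ?_⟩
    rw [← e, ContinuousMap.smul_apply, smul_eq_mul, mul_assoc]

/-- A continuous function on the unit circle with average less than `m` is dominated by the real
part of an entire function whose value at the centre has real part less than `m`. -/
theorem exists_entire_re_gt {h : ℂ → ℝ} (hh : ContinuousOn h (sphere 0 1)) {m : ℝ}
    (hm : circleAverage h 0 1 < m) :
    ∃ q : ℂ → ℂ, Differentiable ℂ q ∧ (∀ z : ℂ, ‖z‖ = 1 → h z < (q z).re) ∧ (q 0).re < m := by
  set e : ℝ := (m - circleAverage h 0 1) / 3 with he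
  have he0 : 0 < e := by rw [he]; linarith
  let H : C(AddCircle (1 : ℝ), ℂ) :=
    ⟨fun x => (h (AddCircle.toCircle x) : ℂ), by
      refine Complex.continuous_ofReal.comp (hh.comp_continuous ?_ ?_)
      · exact continuous_subtype_val.comp AddCircle.continuous_toCircle
      · intro x; rw [mem_sphere_zero_iff_norm]; exact Circle.norm_coe _⟩
  have hH : H ∈ (Submodule.span ℂ (Set.range (fourier (T := 1)))).topologicalClosure := by
    rw [span_fourier_closure_eq_top]; trivial
  obtain ⟨p, hp, hpd⟩ := Metric.mem_closure_iff.1 hH e he0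
  obtain ⟨q, hq, hqe⟩ := exists_entire_re_eq_of_mem_span_fourier hp 1
  have key : ∀ z : ℂ, ‖z‖ = 1 → |h z - (q z).re| < e := by
    intro z hz
    obtain ⟨x, hx⟩ := (AddCircle.homeomorphCircle (T := 1) one_ne_zero).surjective
      ⟨z, by simpa [Submonoid.unitSphere] using hz⟩
    have hx' : (AddCircle.toCircle x : ℂ) = z := by
      rw [← AddCircle.homeomorphCircle_apply (T := 1) one_ne_zero, hx]
    have h1 : ‖H x - p x‖ < e := by
      rw [← dist_eq_norm]; exact (ContinuousMap.dist_apply_le_dist x).trans_lt hpd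
    have h2 := hqe x
    rw [one_mul, hx'] at h2
    refine lt_of_le_of_lt ?_ h1
    have h3 := Complex.abs_re_le_norm (H x - p x)
    rwa [Complex.sub_re, h2, show (H x).re = h z by simp [H, hx']] at h3
  -- Adding `e` gives domination on the circle; the centre then exceeds the average by at most 2e <
  -- 3e.
  refine ⟨fun z => q z + e, by fun_prop, fun z hz => ?_, ?_⟩
  · have := abs_lt.1 (key z hz)
    simp; linarith
  · have h1 : circleAverage (fun z => (q z - (e : ℂ)).re) 0 1 ≤ circleAverage h 0 1 := by
      refine circleAverage_mono ?_ (hh.circleIntegrable zero_le_one) ?_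
      · exact (Complex.continuous_re.comp
          (hq.continuous.sub continuous_const)).continuousOn.circleIntegrable'
      · intro z hz
        have := abs_lt.1 (key z (by simpa using hz))
        simp; linarith
    rw [circleAverage_re_of_differentiable (by fun_prop)] at h1
    simp at h1 ⊢; linarith

/-! ### Maximum principle on quadratic discs, from affine discs only -/

/-- The maximum principle for plurisubharmonic functions along quadratic analytic discs. -/
theorem ContinuousPlurisubharmonicOn.le_of_quadratic_disc {E : Type*} [NormedAddCommGroup E]
    [InnerProductSpace ℂ E] [ProperSpace E] {u : E → ℝ} {G : Set E}
    (hu : ContinuousPlurisubharmonicOn u G) (hG : IsOpen G) {x₀ x₁ x₂ : E}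
    (hmem : ∀ z : ℂ, ‖z‖ ≤ 1 → x₀ + z • x₁ + z ^ 2 • x₂ ∈ G) {c : ℝ}
    (hc : ∀ z : ℂ, ‖z‖ = 1 → u (x₀ + z • x₁ + z ^ 2 • x₂) ≤ c) : u x₀ ≤ c := by
  by_contra! hlt
  set φ : ℂ → E := fun z => x₀ + z • x₁ + z ^ 2 • x₂ with hφ
  have hφc : Continuous φ := by fun_prop
  set κ : ℝ := (u x₀ - c) / 3 with hκ
  have hκ0 : 0 < κ := by rw [hκ]; linarith
  obtain ⟨δ₁, hδ₁, hδ₁G⟩ := ((isCompact_closedBall (0 : ℂ) 1).image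
    hφc).exists_cthickening_subset_open hG (by
      rintro _ ⟨z, hz, rfl⟩
      exact hmem z (by simpa using hz))
  obtain ⟨δ₂, hδ₂, hδ₂W⟩ := ((isCompact_sphere (0 : ℂ) 1).image
    hφc).exists_cthickening_subset_open (hu.1.isOpen_inter_preimage hG (isOpen_Iio (a := c + κ))) (by
      rintro _ ⟨z, hz, rfl⟩
      have hz' : ‖z‖ = 1 := by simpa using hz
      exact ⟨hmem z hz'.le, (hc z hz').trans_lt (by linarith)⟩)
  set δ := min δ₁ δ₂ with hδ
  have hδ0 : 0 < δ := lt_min hδ₁ hδ₂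
  have hG' : ∀ z y, ‖z‖ ≤ 1 → ‖y‖ ≤ δ → φ z + y ∈ G := by
    intro z y hz hy
    refine hδ₁G (mem_cthickening_of_dist_le _ (φ z) _ _ ⟨z, by simpa using hz, rfl⟩ ?_)
    simpa using hy.trans (min_le_left _ _)
  have hW' : ∀ z y, ‖z‖ = 1 → ‖y‖ ≤ δ → u (φ z + y) < c + κ := by
    intro z y hz hy
    refine (hδ₂W (mem_cthickening_of_dist_le _ (φ z) _ _ ⟨z, by simpa using hz, rfl⟩ ?_)).2
    simpa using hy.trans (min_le_right _ _)
  set S : Set (ℂ × E) := closedBall 0 1 ×ˢ closedBall 0 δ with hS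
  have hSc : IsCompact S := (isCompact_closedBall _ _).prod (isCompact_closedBall _ _)
  have hmS : ∀ p, p ∈ S ↔ ‖p.1‖ ≤ 1 ∧ ‖p.2‖ ≤ δ := by intro p; simp [hS]
  have huS : ContinuousOn (fun p : ℂ × E => u (φ p.1 + p.2)) S := by
    refine hu.1.comp (by fun_prop) fun p hp => ?_
    exact hG' _ _ ((hmS p).1 hp).1 ((hmS p).1 hp).2
  obtain ⟨M, hM⟩ := hSc.bddAbove_image huS
  have hM' : ∀ p ∈ S, u (φ p.1 + p.2) ≤ M := fun p hp => hM ⟨p, hp, rfl⟩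
  have h00 : ((0 : ℂ), (0 : E)) ∈ S := by rw [hmS]; simp [hδ0.le]
  have hφ0 : φ 0 = x₀ := by simp [hφ]
  -- Large enough that the penalty at ‖y‖ = δ pushes the perturbed function below its value at (0,
  -- 0).
  set A : ℝ := (M + 2 * κ - u x₀) / δ ^ 2 with hA
  have hA0 : 0 ≤ A := by
    have := hM' _ h00
    simp only [hφ0, add_zero] at this
    rw [hA]; apply div_nonneg _ (by positivity); linarith
  have hAδ : A * δ ^ 2 = M + 2 * κ - u x₀ := by
    rw [hA]; field_simp
  obtain ⟨⟨z₀, y₀⟩, hp₀, hmax⟩ := hSc.exists_isMaxOn ⟨_, h00⟩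
    (f := fun p : ℂ × E => u (φ p.1 + p.2) + κ * ‖p.1‖ ^ 2 - A * ‖p.2‖ ^ 2)
    ((huS.add (by fun_prop)).sub (by fun_prop))
  have hmax' : ∀ z y, ‖z‖ ≤ 1 → ‖y‖ ≤ δ → u (φ z + y) + κ * ‖z‖ ^ 2 - A * ‖y‖ ^ 2 ≤
      u (φ z₀ + y₀) + κ * ‖z₀‖ ^ 2 - A * ‖y₀‖ ^ 2 :=
    fun z y hz hy => hmax ((hmS (z, y)).2 ⟨hz, hy⟩)
  obtain ⟨hz₀, hy₀⟩ := (hmS _).1 hp₀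
  simp only at hz₀ hy₀
  have hV := hmax' 0 0 (by simp) (by simp [hδ0.le])
  simp only [hφ0, add_zero, norm_zero] at hV
  have hz₀' : ‖z₀‖ < 1 := by
    refine lt_of_le_of_ne hz₀ fun h => ?_
    have := hW' z₀ y₀ h hy₀
    rw [h] at hV
    have : 0 ≤ A * ‖y₀‖ ^ 2 := by positivity
    linarith
  have hy₀' : ‖y₀‖ < δ := by
    refine lt_of_le_of_ne hy₀ fun h => ?_
    have h1 := hM' _ hp₀
    simp only at h1
    rw [h, hAδ] at hV
    have : κ * ‖z₀‖ ^ 2 ≤ κ * 1 := by gcongr; exact pow_le_one₀ (norm_nonneg _) hz₀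
    linarith
  obtain ⟨r, ⟨h1, h2, h3⟩, hr⟩ : ∃ r : ℝ, (‖z₀‖ + r < 1 ∧ ‖y₀‖ + r ^ 2 * ‖x₂‖ < δ ∧
      A * r ^ 2 * ‖x₂‖ ^ 2 < κ) ∧ 0 < r := by
    have ev : ∀ {f : ℝ → ℝ} {b : ℝ}, Continuous f → f 0 < b → ∀ᶠ r in 𝓝[>] (0 : ℝ), f r < b :=
      fun hf hb => (hf.continuousAt.eventually (gt_mem_nhds hb)).filter_mono nhdsWithin_le_nhds
    have e1 := ev (f := fun r => ‖z₀‖ + r) (by fun_prop) (by simpa using hz₀')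
    have e2 := ev (f := fun r => ‖y₀‖ + r ^ 2 * ‖x₂‖) (by fun_prop) (by simpa using hy₀')
    have e3 := ev (f := fun r => A * r ^ 2 * ‖x₂‖ ^ 2) (b := κ) (by fun_prop) (by simpa using hκ0)
    exact ((e1.and (e2.and e3)).and self_mem_nhdsWithin).exists
  -- The tangent affine disc is the quadratic disc with its second-order term moved into the
  -- translation `y`, where the maximality of (z₀, y₀) still applies.
  have hdisc : ∀ w : ℂ, (φ z₀ + y₀) + w • ((r : ℂ) • (x₁ + (2 * z₀) • x₂)) =
      φ (z₀ + r * w) + (y₀ - (r ^ 2 * w ^ 2 : ℂ) • x₂) := by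
    intro w; simp only [hφ]; module
  have hn1 : ∀ w : ℂ, ‖w‖ ≤ 1 → ‖z₀ + r * w‖ ≤ 1 := by
    intro w hw
    refine (norm_add_le _ _).trans (le_trans ?_ h1.le)
    rw [norm_mul, Complex.norm_real, norm_of_nonneg hr.le]
    have := mul_le_mul_of_nonneg_left hw hr.le
    linarith
  have hn2 : ∀ w : ℂ, ‖w‖ ≤ 1 → ‖y₀ - (r ^ 2 * w ^ 2 : ℂ) • x₂‖ ≤ δ := by
    intro w hw
    refine (norm_sub_le _ _).trans (le_trans ?_ h2.le)
    rw [norm_smul, norm_mul, norm_pow, norm_pow, Complex.norm_real, norm_of_nonneg hr.le]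
    have := pow_le_one₀ (n := 2) (norm_nonneg _) hw
    gcongr
    nlinarith [sq_nonneg r]
  have hin : ∀ w : ℂ, ‖w‖ ≤ 1 →
      (φ z₀ + y₀) + w • ((r : ℂ) • (x₁ + (2 * z₀) • x₂)) ∈ G := by
    intro w hw
    rw [hdisc]; exact hG' _ _ (hn1 w hw) (hn2 w hw)
  have hsub := hu.2 _ _ hin
  -- On |w| = 1 the bound from maximality is exactly Re Q; at the centre the loss κr² beats the r⁴
  -- term.
  set Q : ℂ → ℂ := fun w => ((u (φ z₀ + y₀) - κ * r ^ 2 + A * r ^ 4 * ‖x₂‖ ^ 2 : ℝ) : ℂ)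
    - 2 * κ * r * conj z₀ * w - 2 * A * r ^ 2 * inner ℂ y₀ x₂ * w ^ 2 with hQ
  have hle := circleAverage_le_re_of_le (q := Q) (by fun_prop)
    (h := fun w : ℂ => u ((φ z₀ + y₀) + w • ((r : ℂ) • (x₁ + (2 * z₀) • x₂))))
    (hu.1.comp (by fun_prop) fun w hw => hin w (by simpa using (mem_sphere_zero_iff_norm.1 hw).le))
    (by
      intro w hw
      have h5 := hmax' _ _ (hn1 w hw.le) (hn2 w hw.le)
      rw [hdisc]
      have h6 : ‖z₀ + r * w‖ ^ 2 = ‖z₀‖ ^ 2 + r ^ 2 + 2 * (r * conj z₀ * w).re := by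
        rw [norm_add_sq (𝕜 := ℂ)]
        simp [hw, RCLike.inner_apply]
        ring
      have h7 : ‖y₀ - (r ^ 2 * w ^ 2 : ℂ) • x₂‖ ^ 2 = ‖y₀‖ ^ 2 + r ^ 4 * ‖x₂‖ ^ 2 -
          2 * (r ^ 2 * inner ℂ y₀ x₂ * w ^ 2).re := by
        rw [norm_sub_sq (𝕜 := ℂ), inner_smul_right, norm_smul, norm_mul, norm_pow, norm_pow, hw,
          Complex.norm_real, norm_of_nonneg hr.le]
        rw [show (r : ℂ) ^ 2 * w ^ 2 * inner ℂ y₀ x₂ = r ^ 2 * inner ℂ y₀ x₂ * w ^ 2 by ring]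
        simp only [RCLike.re_to_complex]
        ring
      have h8 : (Q w).re = u (φ z₀ + y₀) - κ * r ^ 2 + A * r ^ 4 * ‖x₂‖ ^ 2 -
          2 * κ * (r * conj z₀ * w).re - 2 * A * (r ^ 2 * inner ℂ y₀ x₂ * w ^ 2).re := by
        have e1 : (2 * κ * r * conj z₀ * w : ℂ) = ((2 * κ : ℝ) : ℂ) * (r * conj z₀ * w) := by
          push_cast; ring
        have e2 : (2 * A * r ^ 2 * inner ℂ y₀ x₂ * w ^ 2 : ℂ) =
          ((2 * A : ℝ) : ℂ) * (r ^ 2 * inner ℂ y₀ x₂ * w ^ 2) := by push_cast; ring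
        rw [hQ]; dsimp only
        rw [e1, e2, Complex.sub_re, Complex.sub_re, Complex.ofReal_re, Complex.re_ofReal_mul,
          Complex.re_ofReal_mul]
      rw [h8]
      rw [h6, h7] at h5
      linarith)
  have hQ0 : (Q 0).re = u (φ z₀ + y₀) - κ * r ^ 2 + A * r ^ 4 * ‖x₂‖ ^ 2 := by
    simp only [hQ, mul_zero, sub_zero, ne_eq, OfNat.ofNat_ne_zero, not_false_eq_true, zero_pow,
      Complex.ofReal_re]
  rw [hQ0] at hle
  have : r ^ 2 * (A * r ^ 2 * ‖x₂‖ ^ 2) < r ^ 2 * κ := by gcongr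
  nlinarith

/-! ### Fitting the discs into a Hartogs-type region -/

/-- Since |1 - l|² ≤ 2(1 - Re l) on the unit disc, the linear decrease in ε outweighs the ε² term.
The quadratic gain in |1 - l| later absorbs cross terms. -/
theorem norm_one_sub_mul_one_sub_le {ε : ℝ} (hε : 0 ≤ ε) (hε' : ε ≤ 1 / 2) {l : ℂ} (hl : ‖l‖ ≤ 1) :
    ‖1 - ε * (1 - l)‖ ≤ 1 - ε * ‖1 - l‖ ^ 2 / 4 := by
  have h1 : ‖1 - (ε : ℂ) * (1 - l)‖ ^ 2 = 1 - 2 * ε * (1 - l.re) + ε ^ 2 * ‖1 - l‖ ^ 2 := by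
    rw [← Complex.normSq_eq_norm_sq, ← Complex.normSq_eq_norm_sq, Complex.normSq_apply,
      Complex.normSq_apply]
    simp
    ring
  have h2 : ‖1 - l‖ ^ 2 ≤ 2 * (1 - l.re) := by
    have : ‖l‖ ^ 2 ≤ 1 := pow_le_one₀ (norm_nonneg _) hl
    rw [← Complex.normSq_eq_norm_sq, Complex.normSq_apply] at *
    simp
    nlinarith
  have h3 : ‖1 - l‖ ≤ 2 := (norm_sub_le _ _).trans (by rw [norm_one]; linarith)
  have h4 : ‖1 - l‖ ^ 2 ≤ 4 := by nlinarith [norm_nonneg (1 - l)]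
  have h5 : ε * ‖1 - l‖ ^ 2 ≤ ε * (2 * (1 - l.re)) := by gcongr
  have h6 : ε * (ε * ‖1 - l‖ ^ 2) ≤ 1 / 2 * (ε * ‖1 - l‖ ^ 2) := by gcongr
  have h7 : ε * ‖1 - l‖ ^ 2 ≤ 1 / 2 * 4 := by gcongr
  refine abs_le_of_sq_le_sq' ?_ (by linarith) |>.2
  rw [h1]
  nlinarith [sq_nonneg (ε * ‖1 - l‖ ^ 2)]

/-- The disc `l ↦ 1 - ε + l ε (1 + g z + ε γ z²)` stays inside a strictly Hartogs-type region. -/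
theorem norm_lt_of_small {g γ : ℂ} {η ε : ℝ} (hη : 0 < η) (hε : 0 < ε) (hε1 : ε ≤ 1 / 2)
    (h1 : (‖g‖ + 2 * ‖γ‖) * ε < 1 / 16) (h2 : 8 * (‖g‖ + 2 * ‖γ‖) ^ 2 * ε < η / 4)
    {z l : ℂ} (hz : ‖z‖ ≤ 1) (hl : ‖l‖ ≤ 1) (hzl : z ≠ 0 ∨ l ≠ 1) :
    ‖1 - ε + l * ε * (1 + g * z + ε * γ * z ^ 2)‖ <
      ‖1 + g * (l * ε * z) + γ * (l * ε * z) ^ 2‖ * (1 + η * ‖l * ε * z‖ ^ 2) := by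
  set C : ℝ := ‖g‖ + 2 * ‖γ‖ with hC
  set P : ℂ := 1 + g * (l * ε * z) + γ * (l * ε * z) ^ 2 with hP
  set d : ℝ := ‖1 - l‖ with hd
  have hC0 : 0 ≤ C := by positivity
  have hd0 : 0 ≤ d := norm_nonneg _
  have hz0 : 0 ≤ ‖z‖ := norm_nonneg _
  have hw : ‖l * ε * z‖ = ‖l‖ * ε * ‖z‖ := by
    rw [norm_mul, norm_mul, Complex.norm_real, norm_of_nonneg hε.le]
  have hwle : ‖l * ε * z‖ ≤ ε * ‖z‖ := by
    rw [hw]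
    calc ‖l‖ * ε * ‖z‖ ≤ 1 * ε * ‖z‖ := by gcongr
      _ = ε * ‖z‖ := by ring
  have hez : ε * ‖z‖ ≤ 1 := by nlinarith
  have hwsq : ‖l * ε * z‖ ^ 2 ≤ ε * ‖z‖ := by
    calc ‖l * ε * z‖ ^ 2 ≤ (ε * ‖z‖) ^ 2 := by gcongr
      _ = (ε * ‖z‖) * (ε * ‖z‖) := by ring
      _ ≤ (ε * ‖z‖) * 1 := by gcongr
      _ = ε * ‖z‖ := by ring
  have hP1 : ‖P - 1‖ ≤ (‖g‖ + ‖γ‖) * (ε * ‖z‖) := by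
    rw [show P - 1 = g * (l * ε * z) + γ * (l * ε * z) ^ 2 by rw [hP]; ring]
    refine (norm_add_le _ _).trans ?_
    rw [norm_mul g, norm_mul γ, norm_pow, add_mul]
    gcongr
  have hPlow : 1 / 2 ≤ ‖P‖ := by
    have e1 : (1 : ℝ) ≤ ‖P‖ + ‖P - 1‖ := by
      calc (1 : ℝ) = ‖P - (P - 1)‖ := by simp
        _ ≤ _ := norm_sub_le _ _
    have e2 : (‖g‖ + ‖γ‖) * (ε * ‖z‖) ≤ C * (ε * 1) := by
      rw [hC]; gcongr; linarith [norm_nonneg γ]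
    linarith
  have hdiff : ‖ε * (1 - l) * (P - 1 + γ * l * ε * z ^ 2)‖ ≤ ε * d * (C * (ε * ‖z‖)) := by
    rw [norm_mul, norm_mul, Complex.norm_real, norm_of_nonneg hε.le]
    gcongr
    refine (norm_add_le _ _).trans ?_
    have : ‖γ * l * ε * z ^ 2‖ ≤ ‖γ‖ * (ε * ‖z‖) := by
      rw [show γ * l * ε * z ^ 2 = γ * ((l * ε * z) * z) by ring, norm_mul, norm_mul]
      refine mul_le_mul_of_nonneg_left ?_ (norm_nonneg γ)
      calc ‖l * ε * z‖ * ‖z‖ ≤ (ε * ‖z‖) * 1 := by gcongr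
        _ = _ := mul_one _
    rw [hC]; linarith
  have hN : ‖1 - ε + l * ε * (1 + g * z + ε * γ * z ^ 2)‖ ≤
      ‖P‖ * (1 - ε * d ^ 2 / 4) + ε * d * (C * (ε * ‖z‖)) := by
    rw [show 1 - ε + l * ε * (1 + g * z + ε * γ * z ^ 2) =
      P * (1 - ε * (1 - l)) + ε * (1 - l) * (P - 1 + γ * l * ε * z ^ 2) by rw [hP]; ring]
    refine (norm_add_le _ _).trans (add_le_add ?_ hdiff)
    rw [norm_mul]
    gcongr
    exact norm_one_sub_mul_one_sub_le hε.le hε1 hl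
  have hN2 : ε * d * (C * (ε * ‖z‖)) ≤ ‖P‖ * (2 * (ε * d * (C * (ε * ‖z‖)))) := by
    have : 0 ≤ ε * d * (C * (ε * ‖z‖)) := by positivity
    nlinarith
  -- For l near 1, AM-GM splits the cross term between d² and |z|², and the η gain covers the
  -- latter; for l away from 1, the d² term alone suffices.
  have key : -(ε * d ^ 2 / 4) + 2 * (ε * d * (C * (ε * ‖z‖))) < η * ‖l * ε * z‖ ^ 2 := by
    rcases le_total d (1 / 2) with hd2 | hd2
    · have hlow : 1 / 2 ≤ ‖l‖ := by
        have : (1 : ℝ) ≤ ‖l‖ + d := by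
          calc (1 : ℝ) = ‖l + (1 - l)‖ := by simp
            _ ≤ _ := norm_add_le _ _
        linarith
      have e1 : η / 4 * (ε * ‖z‖) ^ 2 ≤ η * ‖l * ε * z‖ ^ 2 := by
        rw [hw]
        have : (1 / 2 * ε * ‖z‖) ^ 2 ≤ (‖l‖ * ε * ‖z‖) ^ 2 := by gcongr
        nlinarith
      have e2 : 2 * (ε * d * (C * (ε * ‖z‖))) ≤
          ε * d ^ 2 / 8 + 8 * C ^ 2 * ε * (ε * ‖z‖) ^ 2 := by
        have : 0 ≤ ε * (d - 8 * C * (ε * ‖z‖)) ^ 2 := by positivity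
        nlinarith
      rcases eq_or_ne z 0 with rfl | hz'
      · have : 0 < d := by
          rw [hd, norm_pos_iff, sub_ne_zero]
          exact (hzl.resolve_left (by simp)).symm
        have : 0 < ε * d ^ 2 := by positivity
        simp only [norm_zero, mul_zero] at *
        linarith
      · have e3 : 0 < (ε * ‖z‖) ^ 2 := by positivity
        have e4 : 8 * C ^ 2 * ε * (ε * ‖z‖) ^ 2 < η / 4 * (ε * ‖z‖) ^ 2 := by gcongr
        have : 0 ≤ ε * d ^ 2 := by positivity
        linarith
    · have e1 : 2 * (ε * d * (C * (ε * ‖z‖))) < ε * d * (1 / 8) := by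
        have : 0 < ε * d := by positivity
        have e2 : C * (ε * ‖z‖) ≤ C * (ε * 1) := by gcongr
        have : ε * d * (C * (ε * ‖z‖)) < ε * d * (1 / 16) := by gcongr; linarith
        linarith
      have e2 : ε * d * (1 / 2) ≤ ε * d * d := by gcongr
      have e3 : 0 ≤ η * ‖l * ε * z‖ ^ 2 := by positivity
      nlinarith
  calc _ ≤ ‖P‖ * (1 - ε * d ^ 2 / 4) + ‖P‖ * (2 * (ε * d * (C * (ε * ‖z‖)))) := by linarith
    _ = ‖P‖ * (1 + (-(ε * d ^ 2 / 4) + 2 * (ε * d * (C * (ε * ‖z‖))))) := by ring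
    _ < _ := by
      have : 0 < ‖P‖ := by linarith
      gcongr

/-! ### Continuity principle for indicatrices -/

/-- A Hartogs-type continuity principle: if all balanced indicatrices near the boundary are
pseudoconvex, then no boundary point is touched from inside by a strictly Hartogs-type region. -/
theorem mem_of_forall_isPseudoconvex_balancedIndicatrix {E : Type*} [NormedAddCommGroup E]
    [InnerProductSpace ℂ E] [ProperSpace E] {D U : Set E} (hD : IsOpen D)
    (hU : U ∈ nhdsSet (frontier D))
    (hI : ∀ a ∈ D ∩ U, IsPseudoconvex (balancedIndicatrix D a))
    {c b ξ : E} {g γ : ℂ} {η ρ : ℝ} (hη : 0 < η) (hρ : 0 < ρ)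
    (hin : ∀ w t : ℂ, ‖w‖ < ρ → ‖t‖ < ‖1 + g * w + γ * w ^ 2‖ * (1 + η * ‖w‖ ^ 2) →
      c + w • b + t • ξ ∈ D) : c + ξ ∈ D := by
  by_contra hnot
  have hlim : Tendsto (fun ε : ℝ => c + ((1 - ε : ℝ) : ℂ) • ξ) (𝓝[>] 0) (𝓝 (c + ξ)) := by
    have : Continuous fun ε : ℝ => c + ((1 - ε : ℝ) : ℂ) • ξ := by fun_prop
    simpa using (this.tendsto 0).mono_left nhdsWithin_le_nhds
  have hsmall : ∀ b : ℝ, 0 < b → ∀ᶠ ε : ℝ in 𝓝[>] 0, ε < b := fun b hb =>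
    (gt_mem_nhds hb).filter_mono nhdsWithin_le_nhds
  have haD : ∀ᶠ ε : ℝ in 𝓝[>] 0, c + ((1 - ε : ℝ) : ℂ) • ξ ∈ D := by
    filter_upwards [hsmall 1 one_pos, self_mem_nhdsWithin] with ε h1 h0
    have h0' : 0 < ε := h0
    have := hin 0 ((1 - ε : ℝ) : ℂ) (by simpa using hρ) (by
      rw [Complex.norm_real, norm_of_nonneg (by linarith)]; simp; linarith)
    simpa using this
  have hfr : c + ξ ∈ frontier D := by
    rw [hD.frontier_eq]
    exact ⟨mem_closure_of_tendsto hlim haD, hnot⟩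
  have haU : ∀ᶠ ε : ℝ in 𝓝[>] 0, c + ((1 - ε : ℝ) : ℂ) • ξ ∈ U :=
    hlim (mem_nhdsSet_iff_forall.1 hU _ hfr)
  have hmulsmall : ∀ k b : ℝ, 0 < b → ∀ᶠ ε : ℝ in 𝓝[>] 0, k * ε < b := fun k b hb => by
    have : Continuous fun ε : ℝ => k * ε := by fun_prop
    exact (this.continuousAt.eventually (gt_mem_nhds (by simpa using hb))).filter_mono
      nhdsWithin_le_nhds
  obtain ⟨ε, ⟨⟨⟨⟨⟨haD, haU⟩, hερ⟩, hε2⟩, hε3⟩, hε4⟩, hε0⟩ := ((((((haD.and haU).and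
    (hsmall ρ hρ)).and (hsmall (1 / 2) (by norm_num))).and
    (hmulsmall (‖g‖ + 2 * ‖γ‖) (1 / 16) (by norm_num))).and
    (hmulsmall (8 * (‖g‖ + 2 * ‖γ‖) ^ 2) (η / 4) (by linarith))).and self_mem_nhdsWithin).exists
  have hε0 : 0 < ε := hε0
  set a := c + ((1 - ε : ℝ) : ℂ) • ξ with ha
  obtain ⟨hIo, u, hu, hcomp⟩ := hI a ⟨haD, haU⟩
  set I := balancedIndicatrix D a with hIdef
  set X : ℂ → E := fun z => (ε * (1 + g * z + ε * γ * z ^ 2)) • ξ + (ε * z) • b with hX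
  have hXc : Continuous X := by fun_prop
  have hXmem : ∀ z s : ℂ, ‖z‖ ≤ 1 → ‖s‖ ≤ 1 → (z ≠ 0 ∨ s ≠ 1) → a + s • X z ∈ D := by
    intro z s hz hs hzs
    have e : a + s • X z = c + (s * ε * z) • b +
        (1 - ε + s * ε * (1 + g * z + ε * γ * z ^ 2)) • ξ := by
      rw [ha, hX]; push_cast; module
    rw [e]
    refine hin _ _ ?_ (norm_lt_of_small hη hε0 hε2.le hε3 hε4 hz hs hzs)
    rw [norm_mul, norm_mul, Complex.norm_real, norm_of_nonneg hε0.le]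
    calc ‖s‖ * ε * ‖z‖ ≤ 1 * ε * 1 := by gcongr
      _ < ρ := by linarith
  have hXI : ∀ (z : ℂ) (s : ℝ), ‖z‖ ≤ 1 → 0 ≤ s → s ≤ 1 → (z ≠ 0 ∨ s < 1) →
      (s : ℂ) • X z ∈ I := by
    intro z s hz hs0 hs1 hzs t ht
    rw [smul_smul]
    have hn : ‖t * (s : ℂ)‖ ≤ s := by
      rw [norm_mul, Complex.norm_real, norm_of_nonneg hs0]
      exact mul_le_of_le_one_left hs0 ht
    refine hXmem z _ hz (hn.trans hs1) (hzs.imp_right fun h h' => ?_)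
    rw [h', norm_one] at hn
    linarith
  have hX0 : X 0 ∉ I := by
    intro h
    have := h 1 (by simp)
    apply hnot
    convert! this using 1
    rw [ha, hX]; push_cast; module
  have hK : IsCompact ((fun p : ℝ × ℂ => (p.1 : ℂ) • X p.2) '' (Set.Icc 0 1 ×ˢ sphere 0 1)) :=
    (isCompact_Icc.prod (isCompact_sphere _ _)).image (by fun_prop)
  have hKI : (fun p : ℝ × ℂ => (p.1 : ℂ) • X p.2) '' (Set.Icc 0 1 ×ˢ sphere 0 1) ⊆ I := by
    rintro _ ⟨⟨s, z⟩, ⟨hs, hz⟩, rfl⟩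
    have hz : ‖z‖ = 1 := by simpa using hz
    exact hXI z s hz.le hs.1 hs.2 (Or.inl (by rintro rfl; simp at hz))
  -- `M` is uniform in s up to s = 1, because the boundary circles avoid z = 0.
  obtain ⟨M, hM⟩ := hK.bddAbove_image (hu.1.mono hKI)
  have hle : ∀ s : ℝ, 0 ≤ s → s < 1 → u ((s : ℂ) • X 0) ≤ M := by
    intro s hs0 hs1
    have e : ∀ z : ℂ, (s * ε : ℂ) • ξ + z • ((s * ε : ℂ) • (g • ξ + b)) +
        z ^ 2 • ((s * ε ^ 2 * γ : ℂ) • ξ) = (s : ℂ) • X z := by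
      intro z; rw [hX]; module
    have := hu.le_of_quadratic_disc hIo (x₀ := (s * ε : ℂ) • ξ)
      (x₁ := (s * ε : ℂ) • (g • ξ + b)) (x₂ := (s * ε ^ 2 * γ : ℂ) • ξ) (c := M)
      (fun z hz => by rw [e]; exact hXI z s hz hs0 hs1.le (Or.inr hs1))
      (fun z hz => by
        rw [e]
        exact hM ⟨_, ⟨⟨s, z⟩, ⟨⟨hs0, hs1.le⟩, by simpa using hz⟩, rfl⟩, rfl⟩)
    rwa [show (s : ℂ) • X 0 = (s * ε : ℂ) • ξ by rw [← e 0]; simp]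
  have hlimX : Tendsto (fun s : ℝ => (s : ℂ) • X 0) (𝓝[<] 1) (𝓝 (X 0)) := by
    have : Continuous fun s : ℝ => (s : ℂ) • X 0 := by fun_prop
    simpa using (this.tendsto 1).mono_left nhdsWithin_le_nhds
  have hev : ∀ᶠ s : ℝ in 𝓝[<] 1, (s : ℂ) • X 0 ∈ {z | z ∈ I ∧ u z ≤ M} := by
    filter_upwards [Ioo_mem_nhdsLT (zero_lt_one' ℝ)] with s hs
    exact ⟨hXI 0 s (by simp) hs.1.le hs.2.le (Or.inr hs.2), hle s hs.1.le hs.2⟩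
  exact hX0 ((hcomp M).isClosed.mem_of_tendsto hlimX hev).1

/-! ### From a failed sub-mean-value inequality to a touching region -/

/-- Second order Taylor polynomials, with a quadratic gain. -/
theorem exists_quadratic_le_mul_exp {G : ℂ → ℂ} (hG : Differentiable ℂ G) (hG0 : G 0 = 1)
    {η : ℝ} (hη : 0 < η) :
    ∃ (g γ : ℂ) (ρ : ℝ), 0 < ρ ∧ ∀ w : ℂ, ‖w‖ < ρ →
      ‖1 + g * w + γ * w ^ 2‖ * (1 + η / 2 * ‖w‖ ^ 2) ≤ ‖G w‖ * exp (η * ‖w‖ ^ 2) := by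
  obtain ⟨p, hp⟩ := hG.analyticAt 0
  obtain ⟨C, hC0, hC⟩ := (hp.isBigO_sub_partialSum_pow 3).exists_pos
  have hp0 : p.coeff 0 = 1 := (hp.coeff_zero _).trans hG0
  have hlow : ∀ᶠ w : ℂ in 𝓝 0, 1 / 2 < ‖G w‖ :=
    hG.continuous.norm.continuousAt.eventually (lt_mem_nhds (by simp only [hG0]; norm_num))
  have hsm : ∀ᶠ w : ℂ in 𝓝 0, 2 * C * ‖w‖ + η * C * ‖w‖ ^ 3 < η / 2 := by
    have : Continuous fun w : ℂ => 2 * C * ‖w‖ + η * C * ‖w‖ ^ 3 := by fun_prop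
    exact this.continuousAt.eventually (gt_mem_nhds (by simpa using hη))
  obtain ⟨ρ, hρ, hball⟩ := Metric.eventually_nhds_iff_ball.1 ((hC.bound.and hlow).and hsm)
  refine ⟨p.coeff 1, p.coeff 2, ρ, hρ, fun w hw => ?_⟩
  obtain ⟨⟨h1, h2⟩, h3⟩ := hball w (by simpa using hw)
  have hps : p.partialSum 3 w = 1 + p.coeff 1 * w + p.coeff 2 * w ^ 2 := by
    simp [FormalMultilinearSeries.partialSum, Finset.sum_range_succ, hp0, mul_comm]
  rw [zero_add, hps, norm_pow, norm_norm] at h1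
  set P := 1 + p.coeff 1 * w + p.coeff 2 * w ^ 2
  -- As |G| > 1/2, the cubic Taylor error is also a relative error; half of η pays for it.
  have h4 : ‖P‖ ≤ ‖G w‖ * (1 + 2 * C * ‖w‖ ^ 3) := by
    have e1 : ‖P‖ ≤ ‖G w‖ + ‖G w - P‖ := by
      calc ‖P‖ = ‖G w - (G w - P)‖ := by simp
        _ ≤ _ := norm_sub_le _ _
    have : 0 ≤ C * ‖w‖ ^ 3 := by positivity
    nlinarith
  have h5 : (1 + 2 * C * ‖w‖ ^ 3) * (1 + η / 2 * ‖w‖ ^ 2) ≤ exp (η * ‖w‖ ^ 2) := by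
    have e1 := add_one_le_exp (η * ‖w‖ ^ 2)
    have e2 : ‖w‖ ^ 2 * (2 * C * ‖w‖ + η * C * ‖w‖ ^ 3) ≤ ‖w‖ ^ 2 * (η / 2) := by gcongr
    nlinarith
  calc _ ≤ ‖G w‖ * (1 + 2 * C * ‖w‖ ^ 3) * (1 + η / 2 * ‖w‖ ^ 2) := by gcongr
    _ = ‖G w‖ * ((1 + 2 * C * ‖w‖ ^ 3) * (1 + η / 2 * ‖w‖ ^ 2)) := by ring
    _ ≤ _ := by gcongr

/-- If `-log dist(·, Dᶜ)` violates the sub-mean value inequality on a disc, then `D` contains a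
strictly Hartogs-type region touching its complement. -/
theorem neg_log_infDist_le_circleAverage {E : Type*} [NormedAddCommGroup E]
    [NormedSpace ℂ E] [ProperSpace E] {D : Set E} (hD : IsOpen D) (hDne : Dᶜ.Nonempty)
    (H : ∀ (c b ξ : E) (g γ : ℂ) (η ρ : ℝ), 0 < η → 0 < ρ →
      (∀ w t : ℂ, ‖w‖ < ρ → ‖t‖ < ‖1 + g * w + γ * w ^ 2‖ * (1 + η * ‖w‖ ^ 2) →
        c + w • b + t • ξ ∈ D) → c + ξ ∈ D)
    {a b : E} (hab : ∀ z : ℂ, ‖z‖ ≤ 1 → a + z • b ∈ D) :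
    -log (infDist a Dᶜ) ≤ circleAverage (fun z : ℂ => -log (infDist (a + z • b) Dᶜ)) 0 1 := by
  have hDc : IsClosed Dᶜ := hD.isClosed_compl
  have hpos : ∀ x ∈ D, 0 < infDist x Dᶜ := fun x hx =>
    (hDc.notMem_iff_infDist_pos hDne).1 (by simpa using hx)
  by_contra! hlt
  have hcont : ContinuousOn (fun z : ℂ => -log (infDist (a + z • b) Dᶜ)) (sphere 0 1) := by
    refine ContinuousOn.neg (ContinuousOn.log ?_ fun z hz => ?_)
    · exact ((continuous_infDist_pt _).comp (by fun_prop)).continuousOn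
    · exact (hpos _ (hab z (by simpa using (mem_sphere_zero_iff_norm.1 hz).le))).ne'
  obtain ⟨f, hf, hfb, hf0⟩ := exists_entire_re_gt hcont hlt
  have haD : a ∈ D := by simpa using hab 0 (by simp)
  have hδ : 0 < infDist a Dᶜ := hpos a haD
  obtain ⟨p, hpD, hpd⟩ := hDc.exists_infDist_eq_dist hDne a
  set ξ := p - a with hξ
  have hξn : ‖ξ‖ = infDist a Dᶜ := by rw [hξ, hpd, dist_eq_norm, norm_sub_rev]
  set η : ℝ := (-log (infDist a Dᶜ) - (f 0).re) / 2 with hη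
  have hη0 : 0 < η := by rw [hη]; linarith
  set v : ℂ → ℝ := fun z => exp ((f z).re - η * ‖z‖ ^ 2) with hv
  have hvc : Continuous v := by
    have := hf.continuous
    fun_prop
  obtain ⟨m, hm0, hm⟩ : ∃ m > 0, ∀ z ∈ closedBall (0 : ℂ) 1, m ≤ v z := by
    obtain ⟨x, -, hx⟩ := (isCompact_closedBall (0 : ℂ) 1).exists_isMinOn
      (nonempty_closedBall.2 zero_le_one) hvc.continuousOn
    exact ⟨v x, exp_pos _, fun z hz => hx hz⟩
  -- The entry 1 keeps (0, 1) in `K`; the other makes the minimum over `K` global in t.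
  set M : ℝ := max 1 (v 0 / m) with hM
  set K : Set (ℂ × ℂ) := (closedBall 0 1 ×ˢ closedBall 0 M) ∩
    (fun q => a + q.1 • b + q.2 • ξ) ⁻¹' Dᶜ with hK
  have hKc : IsCompact K :=
    ((isCompact_closedBall _ _).prod (isCompact_closedBall _ _)).inter_right
      (hDc.preimage (by fun_prop))
  have h01 : ((0 : ℂ), (1 : ℂ)) ∈ K := by
    refine ⟨⟨by simp, by simp [hM]⟩, ?_⟩
    have : a + (0 : ℂ) • b + (1 : ℂ) • ξ = p := by rw [hξ]; simp
    simpa only [Set.mem_preimage, this] using hpD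
  obtain ⟨⟨z₀, t₀⟩, hK₀, hmin⟩ := hKc.exists_isMinOn ⟨_, h01⟩
    (f := fun q : ℂ × ℂ => ‖q.2‖ * v q.1) (by fun_prop)
  have hmin' : ∀ z t : ℂ, ‖z‖ ≤ 1 → ‖t‖ * v z < ‖t₀‖ * v z₀ → a + z • b + t • ξ ∈ D := by
    intro z t hz ht
    by_contra hn
    have h0 : ‖t₀‖ * v z₀ ≤ v 0 := by simpa using hmin h01
    have hzb : z ∈ closedBall (0 : ℂ) 1 := by simpa using hz
    have htM : ‖t‖ ≤ M := by
      refine le_trans ?_ (le_max_right _ _)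
      rw [le_div_iff₀ hm0]
      have := mul_le_mul_of_nonneg_left (hm z hzb) (norm_nonneg t)
      linarith
    exact absurd (hmin (show (z, t) ∈ K from ⟨⟨hzb, by simpa using htM⟩, hn⟩)) (not_le.2 ht)
  have hz₀ : ‖z₀‖ ≤ 1 := by simpa using hK₀.1.1
  have hp₀ : a + z₀ • b + t₀ • ξ ∉ D := hK₀.2
  have hle0 : ‖t₀‖ * v z₀ ≤ v 0 := by simpa using hmin h01
  have ht₀ : t₀ ≠ 0 := by
    rintro rfl
    exact hp₀ (by simpa using hab z₀ hz₀)
  -- On |z₀| = 1, domination by Re f would force the gap 2η at the centre to be less than η.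
  have hz₀' : ‖z₀‖ < 1 := by
    refine lt_of_le_of_ne hz₀ fun h => ?_
    have h1 := hfb z₀ h
    have hd0 := hpos _ (hab z₀ hz₀)
    have h2 : infDist (a + z₀ • b) Dᶜ ≤ ‖t₀‖ * infDist a Dᶜ := by
      refine (infDist_le_dist_of_mem (y := a + z₀ • b + t₀ • ξ) hp₀).trans ?_
      rw [dist_eq_norm, ← hξn, ← norm_smul, ← norm_neg]
      apply le_of_eq; congr 1; abel
    have h3 : log (infDist (a + z₀ • b) Dᶜ) ≤ log ‖t₀‖ + log (infDist a Dᶜ) := by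
      rw [← log_mul (norm_ne_zero_iff.2 ht₀) hδ.ne']
      exact log_le_log hd0 h2
    have h4 := log_le_log (mul_pos (norm_pos_iff.2 ht₀) (exp_pos _)) hle0
    rw [log_mul (norm_ne_zero_iff.2 ht₀) (exp_pos _).ne', log_exp, log_exp, h, norm_zero] at h4
    linarith
  -- Expanding |z₀ + w|², the cross term is the real part of a holomorphic function and joins `f` in
  -- `G`; only η|w|² remains.
  set G : ℂ → ℂ := fun w =>
    Complex.exp (-(f (z₀ + w) - f z₀) + ((2 * η : ℝ) : ℂ) * (conj z₀ * w)) with hG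
  obtain ⟨g, γ, ρ, hρ, hPG⟩ := exists_quadratic_le_mul_exp (G := G) (by fun_prop)
    (by simp [hG]) hη0
  have hGv : ∀ w, ‖G w‖ * exp (η * ‖w‖ ^ 2) * v (z₀ + w) = v z₀ := by
    intro w
    have e : ‖z₀ + w‖ ^ 2 = ‖z₀‖ ^ 2 + 2 * (conj z₀ * w).re + ‖w‖ ^ 2 := by
      rw [← Complex.normSq_eq_norm_sq, ← Complex.normSq_eq_norm_sq, ← Complex.normSq_eq_norm_sq,
        Complex.normSq_apply, Complex.normSq_apply, Complex.normSq_apply]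
      simp; ring
    rw [hG, hv]; dsimp only
    rw [Complex.norm_exp, ← exp_add, ← exp_add, e, Complex.add_re, Complex.re_ofReal_mul,
      Complex.neg_re, Complex.sub_re]
    congr 1; ring
  apply hp₀
  refine H (a + z₀ • b) b (t₀ • ξ) g γ (η / 2) (min ρ (1 - ‖z₀‖)) (by linarith)
    (lt_min hρ (by linarith)) fun w t hw ht => ?_
  have hw1 := lt_of_lt_of_le hw (min_le_left _ _)
  have hw2 := lt_of_lt_of_le hw (min_le_right _ _)
  have := hmin' (z₀ + w) (t * t₀) ((norm_add_le _ _).trans (by linarith)) (by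
    rw [← hGv w, norm_mul]
    have h1 := ht.trans_le (hPG w hw1)
    have h2 : 0 < ‖t₀‖ * v (z₀ + w) := mul_pos (norm_pos_iff.2 ht₀) (exp_pos _)
    have h3 := mul_lt_mul_of_pos_right h1 h2
    linarith)
  convert! this using 1
  module

/-! ### The exhaustion function and the conclusion -/

/-- Sufficiency of plurisubharmonicity of `-log dist(·, Dᶜ)` for pseudoconvexity. -/
theorem isPseudoconvex_of_neg_log_infDist {E : Type*} [NormedAddCommGroup E]
    [NormedSpace ℂ E] [ProperSpace E] {D : Set E} (hD : IsOpen D) (hDne : Dᶜ.Nonempty)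
    (H : ∀ a b : E, (∀ z : ℂ, ‖z‖ ≤ 1 → a + z • b ∈ D) →
      -log (infDist a Dᶜ) ≤ circleAverage (fun z : ℂ => -log (infDist (a + z • b) Dᶜ)) 0 1) :
    IsPseudoconvex D := by
  have hDc : IsClosed Dᶜ := hD.isClosed_compl
  have hpos : ∀ x ∈ D, 0 < infDist x Dᶜ := fun x hx =>
    (hDc.notMem_iff_infDist_pos hDne).1 (by simpa using hx)
  have hlog : ContinuousOn (fun x => -log (infDist x Dᶜ)) D :=
    ((continuous_infDist_pt _).continuousOn.log fun x hx => (hpos x hx).ne').neg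
  have hcont : ContinuousOn (fun x => max (-log (infDist x Dᶜ)) ‖x‖) D :=
    hlog.sup continuous_norm.continuousOn
  -- The maximum with ‖x‖ keeps sublevel sets bounded when `D` is not.
  refine ⟨hD, fun x => max (-log (infDist x Dᶜ)) ‖x‖, ⟨hcont, fun a b hab => ?_⟩, fun c => ?_⟩
  · have hmaps : Set.MapsTo (fun z : ℂ => a + z • b) (sphere 0 1) D := fun z hz =>
      hab z (by simpa using (mem_sphere_zero_iff_norm.1 hz).le)
    have hmax : CircleIntegrable (fun z : ℂ => max (-log (infDist (a + z • b) Dᶜ)) ‖a + z • b‖)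
        0 1 := (hcont.comp (by fun_prop) hmaps).circleIntegrable zero_le_one
    refine max_le ((H a b hab).trans (circleAverage_mono ?_ hmax fun z _ => le_max_left _ _)) ?_
    · exact (hlog.comp (by fun_prop) hmaps).circleIntegrable zero_le_one
    · have hint : CircleIntegrable (fun z : ℂ => ‖a + z • b‖) 0 1 :=
        (by fun_prop : Continuous fun z : ℂ => ‖a + z • b‖).continuousOn.circleIntegrable'
      refine le_trans ?_ (circleAverage_mono hint hmax fun z _ => le_max_right _ _)
      have hmv : circleAverage (fun z : ℂ => a + z • b) 0 1 = a := by
        have hd : Differentiable ℂ fun z : ℂ => a + z • b := by fun_prop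
        simpa using DiffContOnCl.circleAverage (hd.diffContOnCl (s := ball 0 |1|))
      conv_lhs => rw [← hmv]
      rw [circleAverage, circleAverage, norm_smul, norm_of_nonneg (by positivity), smul_eq_mul]
      gcongr
      exact intervalIntegral.norm_integral_le_integral_norm two_pi_pos.le
  · have hset : {x | x ∈ D ∧ max (-log (infDist x Dᶜ)) ‖x‖ ≤ c} =
        {x | exp (-c) ≤ infDist x Dᶜ} ∩ closedBall 0 c := by
      ext x
      simp only [Set.mem_ofPred_eq, Set.mem_inter_iff, mem_closedBall, dist_zero_right, max_le_iff]
      constructor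
      · rintro ⟨hx, h1, h2⟩
        exact ⟨(le_log_iff_exp_le (hpos x hx)).1 (by linarith), h2⟩
      · rintro ⟨h1, h2⟩
        have h0 : 0 < infDist x Dᶜ := (exp_pos _).trans_le h1
        refine ⟨?_, ?_, h2⟩
        · simpa using (hDc.notMem_iff_infDist_pos hDne).2 h0
        · linarith [(le_log_iff_exp_le h0).2 h1]
    rw [hset]
    exact (isCompact_closedBall _ _).inter_left
      (isClosed_le continuous_const (continuous_infDist_pt _))

theorem mainTheorem2 (n : ℕ) (D U : Set (EuclideanSpace ℂ (Fin n)))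
    (hD : IsOpen D) (hproper : D ≠ Set.univ)
    (hU : U ∈ nhdsSet (frontier D))
    (hI : ∀ a ∈ D ∩ U, IsPseudoconvex (balancedIndicatrix D a)) :
    IsPseudoconvex D := by
  have hDne : Dᶜ.Nonempty := Set.nonempty_compl.2 hproper
  refine isPseudoconvex_of_neg_log_infDist hD hDne fun a b hab => ?_
  exact neg_log_infDist_le_circleAverage hD hDne (fun _ _ _ _ _ _ _ hη hρ hin =>
    mem_of_forall_isPseudoconvex_balancedIndicatrix hD hU hI hη hρ hin) hab
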